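/- Let $X$ be a compact Hausdorff space that is $h$-homogeneous: $X$ has a base of clopen sets and all non-empty clopen subsets of $X$ are homeomorphic to each other. Let $G=\operatorname{Aut}(X)$ be the group of all self-homeomorphisms of $X$ with the compact-open topology. The Roelcke uniformity of $G$ is the greatest lower bound $\mathcal L\wedge\mathcal R$ of the left and right uniformities (the finest uniformity coarser than both); $G$ is Roelcke-precompact if it is precompact for this uniformity, and then its Roelcke compactification is the completion of $(G,\mathcal L\wedge\mathcal R)$. Let $E_0(X)$ be the set of all closed relations $R\subset X^2$ such that for every $x\in X$ there are $y,z\in X$ with $(x,y)\in R$ and $(z,x)\in R$ (full domain and full range), with the Vietoris topology and with the multiplication $RS=\{(x,y):\exists z\,((x,z)\in S\text{ and }(z,y)\in R)\}$, and for $g\in G$ let $\Gamma(g)=\{(x,g(x)):x\in X\}\in E_0(X)$. Then: (1) $G$ is Roelcke-precompact, and its Roelcke compactification can be identified with the semigroup $E_0(X)$: the map $\Gamma$ is an injective homomorphism of $G$ to $E_0(X)$ whose image is the set of all invertible elements of $E_0(X)$, and there is a homeomorphism $\Phi$ of the Roelcke compactification of $G$ onto $E_0(X)$ such that $\Phi(g)=\Gamma(g)$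 for every $g\in G$. (2) $G$ is minimal (it is Hausdorff and admits no strictly coarser Hausdorff group topology) and topologically simple (its only closed normal subgroups are $\{1\}$ and $G$). -/

import Mathlib

/-! ### General notions for topological groups -/

/-- The Roelcke uniformity `L ∧ R` of a topological group: the greatest lower bound of the left and
the right uniformity, i.e. the finest uniformity that is coarser than both. (In Mathlib's order on
uniformities `u ≤ v` means that `u` is finer than `v`, so this is a supremum there.) -/
@[reducible]
def roelckeUniformSpace (G : Type*) [Group G] [TopologicalSpace G] [IsTopologicalGroup G] :
    UniformSpace G :=
  IsTopologicalGroup.leftUniformSpace G ⊔ IsTopologicalGroup.rightUniformSpace G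

/-- A topological group is Roelcke-precompact if it is precompact (totally bounded) with respect
to its Roelcke uniformity. -/
def IsRoelckePrecompact (G : Type*) [Group G] [TopologicalSpace G] [IsTopologicalGroup G] : Prop :=
  @TotallyBounded G (roelckeUniformSpace G) Set.univ

/-- The Roelcke completion of a topological group: the (Hausdorff) completion of the group with
respect to the Roelcke uniformity. It is called the Roelcke compactification if the group is
Roelcke-precompact. -/
def RoelckeCompletion (G : Type*) [Group G] [TopologicalSpace G] [IsTopologicalGroup G] : Type _ :=
  @UniformSpace.Completion G (roelckeUniformSpace G)

instance RoelckeCompletion.instUniformSpace (G : Type*) [Group G] [TopologicalSpace G]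
    [IsTopologicalGroup G] : UniformSpace (RoelckeCompletion G) :=
  @UniformSpace.Completion.uniformSpace G (roelckeUniformSpace G)

/-- The canonical map of a topological group to its Roelcke completion. -/
def RoelckeCompletion.of {G : Type*} [Group G] [TopologicalSpace G] [IsTopologicalGroup G]
    (g : G) : RoelckeCompletion G :=
  @UniformSpace.Completion.coe' G (roelckeUniformSpace G) g

/-- A (Hausdorff) group topology is minimal if there is no strictly coarser Hausdorff group
topology. (In Mathlib's order on topologies `s ≤ t` means that `t` is coarser than `s`.) -/
def IsMinimalTopologicalGroup (G : Type*) [Group G] [τ : TopologicalSpace G] : Prop :=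
  IsTopologicalGroup G ∧ T2Space G ∧
    ∀ τ' : TopologicalSpace G, @IsTopologicalGroup G τ' _ → @T2Space G τ' → τ ≤ τ' → τ' = τ

/-- A topological group is topologically simple if it has no closed normal subgroups besides the
trivial subgroup and the whole group. -/
def IsTopologicallySimple (G : Type*) [Group G] [TopologicalSpace G] : Prop :=
  ∀ N : Subgroup G, N.Normal → IsClosed (N : Set G) → N = ⊥ ∨ N = ⊤

/-- `h`-homogeneity: the space is zero-dimensional, i.e. it has a base of clopen sets, and all its
non-empty clopen subsets are homeomorphic to each other. -/
structure IsHHomogeneous (X : Type*) [TopologicalSpace X] : Prop where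
  zeroDimensional : TopologicalSpace.IsTopologicalBasis {U : Set X | IsClopen U}
  homeomorphic : ∀ U V : Set X, IsClopen U → IsClopen V → U.Nonempty → V.Nonempty →
    Nonempty (U ≃ₜ V)

/-! ### The group `Aut X = (X ≃ₜ X)` of self-homeomorphisms with the compact-open topology -/

section Aut

variable {X : Type*} [TopologicalSpace X]

/-- The compact-open topology on the group of self-homeomorphisms. -/
instance Aut.instTopologicalSpace : TopologicalSpace (X ≃ₜ X) :=
  TopologicalSpace.induced (fun f => (f : C(X, X))) ContinuousMap.compactOpen

theorem Aut.isInducing_coe : Topology.IsInducing (fun f : X ≃ₜ X => (f : C(X, X))) := ⟨rfl⟩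

instance Aut.instIsTopologicalGroup [CompactSpace X] [T2Space X] :
    IsTopologicalGroup (X ≃ₜ X) where
  continuous_mul := by
    rw [Aut.isInducing_coe.continuous_iff]
    exact (Aut.isInducing_coe.continuous.comp continuous_fst).compCM
      (Aut.isInducing_coe.continuous.comp continuous_snd)
  continuous_inv := by
    rw [Aut.isInducing_coe.continuous_iff, ContinuousMap.continuous_compactOpen]
    intro K hK U hU
    have key : {f : X ≃ₜ X | Set.MapsTo (((f⁻¹ : X ≃ₜ X) : C(X, X))) K U}
        = (fun f : X ≃ₜ X => (f : C(X, X))) ⁻¹' {g : C(X, X) | Set.MapsTo g Uᶜ Kᶜ} := by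
      ext f
      constructor
      · intro h x hx hfx
        have := h hfx
        exact hx (by simpa using this)
      · intro h y hy
        by_contra hn
        have := h hn
        exact this (by simpa using hy)
    exact key ▸ (ContinuousMap.isOpen_setOfPred_mapsTo hU.isClosed_compl.isCompact
      hK.isClosed.isOpen_compl).preimage Aut.isInducing_coe.continuous

end Aut

/-! ### The semigroup `E₀(X)` of closed relations with full domain and range -/

/-- `E₀(X)`: the closed relations `R ⊆ X × X` with `Dom R = Ran R = X`. -/
def FullClosedRel (X : Type*) [TopologicalSpace X] : Type _ :=
  {R : SetRel X X // IsClosed R ∧ R.dom = Set.univ ∧ R.cod = Set.univ}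

namespace FullClosedRel

section

variable {X : Type*} [TopologicalSpace X]

/-- The Vietoris topology on `E₀(X)`: it is generated by the sets `{R | R ⊆ U}` and
`{R | R ∩ U ≠ ∅}` for `U` open in `X × X`. -/
instance instTopologicalSpace : TopologicalSpace (FullClosedRel X) :=
  TopologicalSpace.induced Subtype.val (TopologicalSpace.vietoris (X × X))

theorem isClosed_comp [CompactSpace X] {R S : SetRel X X} (hR : IsClosed R) (hS : IsClosed S) :
    IsClosed (SetRel.comp S R) := by
  have h : SetRel.comp S R = (fun p : (X × X) × X => p.1) ''
      {p : (X × X) × X | (p.1.1, p.2) ∈ S ∧ (p.2, p.1.2) ∈ R} := by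
    ext ⟨x, y⟩
    simp [SetRel.comp]
  rw [h]
  exact isClosedMap_fst_of_compactSpace _
    ((hS.preimage (by fun_prop)).inter (hR.preimage (by fun_prop)))

/-- The composition `R S = {(x, y) | ∃ z, (x, z) ∈ S ∧ (z, y) ∈ R}`. -/
instance instMul [CompactSpace X] : Mul (FullClosedRel X) where
  mul R S := ⟨{p : X × X | ∃ z, (p.1, z) ∈ S.1 ∧ (z, p.2) ∈ R.1},
    isClosed_comp R.2.1 S.2.1, by
      refine Set.eq_univ_of_forall fun x => ?_
      obtain ⟨z, hz⟩ := Set.eq_univ_iff_forall.1 S.2.2.1 x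
      obtain ⟨y, hy⟩ := Set.eq_univ_iff_forall.1 R.2.2.1 z
      exact ⟨y, z, hz, hy⟩, by
      refine Set.eq_univ_of_forall fun y => ?_
      obtain ⟨z, hz⟩ := Set.eq_univ_iff_forall.1 R.2.2.2 y
      obtain ⟨x, hx⟩ := Set.eq_univ_iff_forall.1 S.2.2.2 z
      exact ⟨x, z, hx, hz⟩⟩

theorem mem_mul [CompactSpace X] (R S : FullClosedRel X) (x y : X) :
    (x, y) ∈ (R * S).1 ↔ ∃ z, (x, z) ∈ S.1 ∧ (z, y) ∈ R.1 := Iff.rfl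

/-- The graph `{(x, f x) | x ∈ X}` of a self-homeomorphism, as an element of `E₀(X)`. -/
def graph [T2Space X] (f : X ≃ₜ X) : FullClosedRel X :=
  ⟨{p : X × X | f p.1 = p.2}, isClosed_eq (f.continuous.comp continuous_fst) continuous_snd,
    Set.eq_univ_of_forall fun x => ⟨f x, rfl⟩,
    Set.eq_univ_of_forall fun y => ⟨f.symm y, f.apply_symm_apply y⟩⟩

theorem mem_graph [T2Space X] (f : X ≃ₜ X) (x y : X) : (x, y) ∈ (graph f).1 ↔ f x = y := Iff.rfl

/-- `E₀(X)` is a semigroup under composition of relations, with the diagonal as its unit. -/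
instance instMonoid [CompactSpace X] [T2Space X] : Monoid (FullClosedRel X) where
  one := graph 1
  mul_assoc Q R S := by
    refine Subtype.ext (Set.ext fun ⟨x, y⟩ => ?_)
    simp only [mem_mul]
    constructor
    · rintro ⟨z, hxz, w, hzw, hwy⟩
      exact ⟨w, ⟨z, hxz, hzw⟩, hwy⟩
    · rintro ⟨w, ⟨z, hxz, hzw⟩, hwy⟩
      exact ⟨z, hxz, w, hzw, hwy⟩
  one_mul R := by
    refine Subtype.ext (Set.ext fun ⟨x, y⟩ => ?_)
    change (∃ z, (x, z) ∈ R.1 ∧ z = y) ↔ _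
    simp
  mul_one R := by
    refine Subtype.ext (Set.ext fun ⟨x, y⟩ => ?_)
    change (∃ z, x = z ∧ (z, y) ∈ R.1) ↔ _
    simp

end

/-- The morphism of semigroups `Aut X → E₀(X)` that sends a self-homeomorphism to its graph. -/
def graphHom (X : Type*) [TopologicalSpace X] [CompactSpace X] [T2Space X] :
    (X ≃ₜ X) →* FullClosedRel X where
  toFun := graph
  map_one' := rfl
  map_mul' f g := by
    refine Subtype.ext (Set.ext fun ⟨x, y⟩ => ?_)
    simp only [mem_mul, mem_graph, Homeomorph.mul_apply]
    simp

end FullClosedRel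

open Set Filter Topology Uniformity

/-! ### Locally constant colourings of `h`-homogeneous spaces -/

section Colourings

variable {X : Type*} [TopologicalSpace X]

/-! Everything is tested on clopen partitions (discrete quotients) `Q`, through the finite trace of
a relation: the set of pairs of cells that it meets. By h-homogeneity, two partitions indexed by the
same colours differ by a homeomorphism. Hence the trace of a graph on `Q` determines the double
coset of the homeomorphism modulo the stabilizer of `Q` (`exists_eq_mul_of_relTrace_eq`). These
stabilizers are a base at the identity, so the Roelcke uniformity is the one induced by traces. On
`E₀(X)` traces define the compact Vietoris topology, and every trace is realized by a graph, so
`E₀(X)` is the completion.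

Minimality and simplicity both follow from a dichotomy: for nontrivial `X`, a continuous
homomorphism `φ` to a Hausdorff group is trivial or an embedding. Consider the limits in `E₀(X)` of
homeomorphisms whose `φ`-images tend to 1. If such limits identify two distinct points, then
homogeneity and composition give elements `f` with `φ f` near 1 and full trace; `f` and `f * h` then
share a double coset, which forces `φ h = 1` for every `h`. Otherwise `φ` is injective and each
limit is a graph in its kernel, hence the identity, so `φ` is an embedding. -/

theorem IsHHomogeneous.totallySeparatedSpace [T2Space X] (hX : IsHHomogeneous X) :
    TotallySeparatedSpace X := by
  refine totallySeparatedSpace_iff_exists_isClopen.2 fun x y hxy => ?_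
  obtain ⟨U, hU, hxU, hUy⟩ := hX.zeroDimensional.mem_nhds_iff.1
    (isOpen_compl_singleton.mem_nhds (show x ∈ ({y} : Set X)ᶜ from hxy))
  exact ⟨U, hU, hxU, fun h => hUy h rfl⟩

/-- In a finite Hausdorff space a singleton is clopen, hence would be homeomorphic to the whole
space. -/
theorem IsHHomogeneous.infinite [T2Space X] [Nontrivial X] (hX : IsHHomogeneous X) :
    Infinite X := by
  by_contra hfin
  rw [not_infinite_iff_finite] at hfin
  obtain ⟨x⟩ : Nonempty X := inferInstance
  obtain ⟨e⟩ := hX.homeomorphic univ {x} isClopen_univ (isClopen_discrete _) ⟨x, trivial⟩ ⟨x, rfl⟩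
  obtain ⟨a, b, hab⟩ := exists_pair_ne X
  exact hab (congrArg Subtype.val
    (e.injective (Subsingleton.elim (e ⟨a, trivial⟩) (e ⟨b, trivial⟩))))

/-- Two locally constant colourings with the same colours differ by a self-homeomorphism. -/
theorem IsHHomogeneous.exists_homeomorph [CompactSpace X] [T2Space X] (hX : IsHHomogeneous X)
    {ι : Type*} {c d : X → ι} (hc : IsLocallyConstant c) (hd : IsLocallyConstant d)
    (hcd : range c = range d) : ∃ g : X ≃ₜ X, ∀ x, d (g x) = c x := by
  have key : ∀ i, Nonempty ({x // c x = i} ≃ₜ {x // d x = i}) := by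
    intro i
    by_cases hi : i ∈ range c
    · exact hX.homeomorphic {x | c x = i} {x | d x = i} (hc.isClopen_fiber i) (hd.isClopen_fiber i)
        hi (by rw [hcd] at hi; exact hi)
    · have h1 : IsEmpty {x // c x = i} := ⟨fun x => hi ⟨x.1, x.2⟩⟩
      have h2 : IsEmpty {x // d x = i} := ⟨fun x => hi (hcd ▸ ⟨x.1, x.2⟩)⟩
      exact ⟨Homeomorph.empty⟩
  let e i := (key i).some
  -- The homeomorphisms between fibres are glued. The result is continuous because the fibres of `c`
  -- are open; compactness takes care of the inverse.
  let E : X ≃ X := (Equiv.sigmaFiberEquiv c).symm.trans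
    ((Equiv.sigmaCongrRight fun i => (e i).toEquiv).trans (Equiv.sigmaFiberEquiv d))
  have hE : ∀ i (x : X) (hx : c x = i), E x = (e i ⟨x, hx⟩).1 := by
    rintro i x rfl
    rfl
  have hcont : Continuous E := by
    refine continuous_iff_continuousAt.2 fun x => ?_
    have hon : ContinuousOn E {y | c y = c x} := by
      rw [continuousOn_iff_continuous_domRestrict]
      have : ({y | c y = c x} : Set X).domRestrict E = fun y => (e (c x) ⟨y.1, y.2⟩).1 :=
        funext fun y => hE _ _ y.2
      rw [this]
      exact continuous_subtype_val.comp ((e (c x)).continuous.comp continuous_id)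
    exact hon.continuousAt ((hc.isOpen_fiber (c x)).mem_nhds rfl)
  refine ⟨hcont.homeoOfEquivCompactToT2, fun x => ?_⟩
  change d (E x) = c x
  rw [hE _ x rfl]
  exact (e (c x) ⟨x, rfl⟩).2

theorem DiscreteQuotient.exists_proj_ne [TotallySeparatedSpace X] {x y : X} (h : x ≠ y) :
    ∃ Q : DiscreteQuotient X, Q.proj x ≠ Q.proj y := by
  obtain ⟨U, hU, hx, hy⟩ := exists_isClopen_of_totally_separated h
  refine ⟨.ofIsClopen hU, fun h' => ?_⟩
  exact hy ((Quotient.eq''.1 h' : x ∈ U ↔ y ∈ U).1 hx)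

theorem DiscreteQuotient.proj_eq_of_le {P Q : DiscreteQuotient X} (h : P ≤ Q) {x y : X}
    (hxy : P.proj x = P.proj y) : Q.proj x = Q.proj y := by
  rw [← DiscreteQuotient.ofLE_proj h, hxy, DiscreteQuotient.ofLE_proj]

theorem DiscreteQuotient.proj_comap_eq_iff {Y : Type*} [TopologicalSpace Y]
    {Q : DiscreteQuotient Y} {f : C(X, Y)} {x y : X} :
    (Q.comap f).proj x = (Q.comap f).proj y ↔ Q.proj (f x) = Q.proj (f y) := by
  have h1 : (Q.comap f).proj x = (Q.comap f).proj y ↔ Q.toSetoid (f x) (f y) := Quotient.eq''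
  have h2 : Q.proj (f x) = Q.proj (f y) ↔ Q.toSetoid (f x) (f y) := Quotient.eq''
  exact h1.trans h2.symm

/-- Finitely many points in a totally separated space have a locally constant retraction. -/
theorem exists_isLocallyConstant_leftInverse [TotallySeparatedSpace X] {κ : Type*}
    [Finite κ] [Nonempty κ] {a : κ → X} (ha : Function.Injective a) :
    ∃ s : X → κ, IsLocallyConstant s ∧ ∀ k, s (a k) = k := by
  have : ∀ p : κ × κ, ∃ Q : DiscreteQuotient X, p.1 ≠ p.2 → Q.proj (a p.1) ≠ Q.proj (a p.2) := by
    intro p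
    by_cases hp : p.1 = p.2
    · exact ⟨⊤, fun h => absurd hp h⟩
    · obtain ⟨Q, hQ⟩ := DiscreteQuotient.exists_proj_ne (ha.ne hp)
      exact ⟨Q, fun _ => hQ⟩
  choose Q hQ using this
  obtain ⟨P, hP⟩ := Finite.exists_ge Q
  have hinj : Function.Injective fun k => P.proj (a k) := by
    intro k l hkl
    by_contra hne
    exact hQ (k, l) hne (DiscreteQuotient.proj_eq_of_le (hP (k, l)) hkl)
  exact ⟨fun x => Function.invFun (fun k => P.proj (a k)) (P.proj x),
    P.proj_isLocallyConstant.comp (Function.invFun fun k => P.proj (a k)),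
    fun k => Function.leftInverse_invFun hinj k⟩

/-- A colouring may be refined to a colouring with any prescribed finite set of non-empty pieces
in each of its pieces. -/
theorem IsHHomogeneous.exists_refinement [CompactSpace X] [T2Space X] [Nontrivial X]
    (hX : IsHHomogeneous X) {ι T : Type*} [Finite T] {c : X → ι} (hc : IsLocallyConstant c)
    {r : T → ι} (hr : range r = range c) :
    ∃ c' : X → T, IsLocallyConstant c' ∧ Function.Surjective c' ∧ ∀ x, r (c' x) = c x := by
  have := hX.infinite
  have := hX.totallySeparatedSpace
  have : Nonempty T := by
    obtain ⟨x⟩ : Nonempty X := inferInstance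
    obtain ⟨t, -⟩ : c x ∈ range r := hr ▸ mem_range_self x
    exact ⟨t⟩
  obtain ⟨n, ⟨e⟩⟩ := Finite.exists_equiv_fin T
  obtain ⟨s, hs, hsa⟩ := exists_isLocallyConstant_leftInverse (X := X)
    (a := fun t => Infinite.natEmbedding X (e t))
    ((Infinite.natEmbedding X).injective.comp (Fin.val_injective.comp e.injective))
  -- Some locally constant `s` takes all values in `T`. Then `r ∘ s` and `c` have the same colours,
  -- and a homeomorphism matching them transports `s` to a refinement of `c`.
  have hsurj : Function.Surjective s := fun t => ⟨_, hsa t⟩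
  obtain ⟨g, hg⟩ := hX.exists_homeomorph hc (hs.comp r)
    (by rw [hsurj.range_comp, hr])
  exact ⟨s ∘ g, hs.comp_continuous g.continuous, hsurj.comp g.surjective, hg⟩

/-- The group of self-homeomorphisms is `k`-homogeneous up to locally constant colourings. -/
theorem IsHHomogeneous.exists_apply_mem [CompactSpace X] [T2Space X] [Nontrivial X]
    (hX : IsHHomogeneous X) {ι κ : Type*} [Finite κ] {c : X → ι} (hc : IsLocallyConstant c)
    {a : κ → X} (ha : Function.Injective a) (b : κ → X) :
    ∃ g : X ≃ₜ X, ∀ k, c (g (a k)) = c (b k) := by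
  have := hX.infinite
  have := hX.totallySeparatedSpace
  have hfin : Finite (range c) := hc.range_finite
  obtain ⟨n, ⟨e⟩⟩ := Finite.exists_equiv_fin (range c)
  have hinf : Infinite ((range a)ᶜ : Set X) := (finite_range a).infinite_compl.to_subtype
  -- One spare point per colour is added, so that the recolouring `t ∘ s` below uses every colour of
  -- `c`, even those missed by `b`.
  let a' : κ ⊕ range c → X :=
    Sum.elim a fun i => (Infinite.natEmbedding ((range a)ᶜ : Set X) (e i)).1
  have ha' : Function.Injective a' := by
    refine ha.sumElim (Subtype.val_injective.comp ((Infinite.natEmbedding _).injective.comp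
      (Fin.val_injective.comp e.injective))) fun k i h => ?_
    exact (Infinite.natEmbedding ((range a)ᶜ : Set X) (e i)).2 ⟨k, h⟩
  have : Nonempty (range c) := by
    obtain ⟨x⟩ : Nonempty X := inferInstance
    exact ⟨⟨c x, x, rfl⟩⟩
  obtain ⟨s, hs, hsa⟩ := exists_isLocallyConstant_leftInverse ha'
  let t : κ ⊕ range c → ι := Sum.elim (fun k => c (b k)) Subtype.val
  have hst : range (t ∘ s) = range c := by
    have hsurj : Function.Surjective s := fun k => ⟨_, hsa k⟩
    rw [hsurj.range_comp, Sum.elim_range, Subtype.range_coe, union_eq_right]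
    rintro _ ⟨k, rfl⟩
    exact ⟨b k, rfl⟩
  obtain ⟨g, hg⟩ := hX.exists_homeomorph (hs.comp t) hc hst
  refine ⟨g, fun k => ?_⟩
  rw [hg]
  change t (s (a' (Sum.inl k))) = _
  rw [hsa]
  rfl

end Colourings

/-! ### Traces of relations on colourings -/

section Trace

variable {X : Type*} {ι : Type*}

/-- The trace of a relation on a colouring: the pairs of colours of related points. -/
def relTrace (c : X → ι) (R : Set (X × X)) : Set (ι × ι) := Prod.map c c '' R

theorem mem_relTrace {c : X → ι} {R : Set (X × X)} {i j : ι} :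
    (i, j) ∈ relTrace c R ↔ ∃ x y, (x, y) ∈ R ∧ c x = i ∧ c y = j := by
  simp [relTrace]

theorem mk_mem_relTrace {c : X → ι} {R : Set (X × X)} {x y : X} (h : (x, y) ∈ R) :
    (c x, c y) ∈ relTrace c R := ⟨(x, y), h, rfl⟩

variable [TopologicalSpace X]

theorem mem_relTrace_graph [T2Space X] {c : X → ι} {g : X ≃ₜ X} {i j : ι} :
    (i, j) ∈ relTrace c (FullClosedRel.graph g).1 ↔ ∃ x, c x = i ∧ c (g x) = j := by
  rw [mem_relTrace]
  constructor
  · rintro ⟨x, y, hxy, hx, hy⟩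
    exact ⟨x, hx, (congrArg c hxy).trans hy⟩
  · rintro ⟨x, hx, hy⟩
    exact ⟨x, g x, rfl, hx, hy⟩

theorem relTrace_graph [T2Space X] (c : X → ι) (g : X ≃ₜ X) :
    relTrace c (FullClosedRel.graph g).1 = range fun x => (c x, c (g x)) := by
  ext ⟨i, j⟩
  simp [mem_relTrace_graph]

theorem FullClosedRel.relTrace_graph_mul_left [T2Space X] {c : X → ι} {b : X ≃ₜ X}
    (hb : ∀ x, c (b x) = c x) (g : X ≃ₜ X) :
    relTrace c (FullClosedRel.graph (b * g)).1 = relTrace c (FullClosedRel.graph g).1 := by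
  simp [relTrace_graph, Homeomorph.mul_apply, hb]

theorem FullClosedRel.relTrace_graph_mul_right [T2Space X] {c : X → ι} {a : X ≃ₜ X}
    (ha : ∀ x, c (a x) = c x) (g : X ≃ₜ X) :
    relTrace c (FullClosedRel.graph (g * a)).1 = relTrace c (FullClosedRel.graph g).1 := by
  rw [relTrace_graph, relTrace_graph, ← a.surjective.range_comp fun x => (c x, c (g x))]
  congr 1
  funext x
  simp [Homeomorph.mul_apply, ha]

theorem relTrace_eq_of_le {P Q : DiscreteQuotient X} (h : P ≤ Q) {R S : Set (X × X)}
    (hRS : relTrace P.proj R = relTrace P.proj S) : relTrace Q.proj R = relTrace Q.proj S := by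
  have key : ∀ R : Set (X × X), relTrace Q.proj R =
      Prod.map (DiscreteQuotient.ofLE h) (DiscreteQuotient.ofLE h) '' relTrace P.proj R := by
    intro R
    rw [relTrace, relTrace, image_image]
    rfl
  rw [key, key, hRS]

/-- Boxes of pieces of discrete quotients are a neighbourhood base, uniformly on compact sets. -/
theorem IsCompact.exists_discreteQuotient_box [CompactSpace X] [TotallySeparatedSpace X]
    {K U : Set (X × X)} (hK : IsCompact K) (hU : IsOpen U) (hKU : K ⊆ U) :
    ∃ Q : DiscreteQuotient X, ∀ x y x' y', (x, y) ∈ K → Q.proj x' = Q.proj x →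
      Q.proj y' = Q.proj y → (x', y') ∈ U := by
  refine hK.induction_on (p := fun L => ∃ Q : DiscreteQuotient X, ∀ x y x' y', (x, y) ∈ L →
    Q.proj x' = Q.proj x → Q.proj y' = Q.proj y → (x', y') ∈ U) ?_ ?_ ?_ ?_
  · exact ⟨⊤, by simp⟩
  · rintro s t hst ⟨Q, hQ⟩
    exact ⟨Q, fun x y x' y' h => hQ x y x' y' (hst h)⟩
  · rintro s t ⟨P, hP⟩ ⟨Q, hQ⟩
    refine ⟨P ⊓ Q, fun x y x' y' h hx hy => ?_⟩
    rcases h with h | h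
    · exact hP x y x' y' h (DiscreteQuotient.proj_eq_of_le inf_le_left hx)
        (DiscreteQuotient.proj_eq_of_le inf_le_left hy)
    · exact hQ x y x' y' h (DiscreteQuotient.proj_eq_of_le inf_le_right hx)
        (DiscreteQuotient.proj_eq_of_le inf_le_right hy)
  · rintro ⟨x, y⟩ hxy
    obtain ⟨A, B, hA, hxA, hB, hyB, hAB⟩ := mem_nhds_prod_iff'.1 (hU.mem_nhds (hKU hxy))
    obtain ⟨C, hC, hxC, hCA⟩ := compact_exists_isClopen_in_isOpen hA hxA
    obtain ⟨D, hD, hyD, hDB⟩ := compact_exists_isClopen_in_isOpen hB hyB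
    refine ⟨C ×ˢ D, mem_nhdsWithin_of_mem_nhds
      ((hC.isOpen.prod hD.isOpen).mem_nhds ⟨hxC, hyD⟩), .ofIsClopen hC ⊓ .ofIsClopen hD, ?_⟩
    rintro a b a' b' ⟨ha, hb⟩ haa hbb
    have h1 : a' ∈ C ↔ a ∈ C := Quotient.eq''.1
      (DiscreteQuotient.proj_eq_of_le (Q := .ofIsClopen hC) inf_le_left haa)
    have h2 : b' ∈ D ↔ b ∈ D := Quotient.eq''.1
      (DiscreteQuotient.proj_eq_of_le (Q := .ofIsClopen hD) inf_le_right hbb)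
    exact hAB ⟨hCA (h1.2 ha), hDB (h2.2 hb)⟩

end Trace

/-! ### Topology and uniformity of `E₀(X)` -/

namespace FullClosedRel

variable {X : Type*} [TopologicalSpace X]

theorem exists_mem_left (R : FullClosedRel X) (x : X) : ∃ y, (x, y) ∈ R.1 :=
  Set.eq_univ_iff_forall.1 R.2.2.1 x

theorem exists_mem_right (R : FullClosedRel X) (y : X) : ∃ x, (x, y) ∈ R.1 :=
  Set.eq_univ_iff_forall.1 R.2.2.2 y

/-- A point outside a closed relation has a box of cells disjoint from that relation, and the trace
sees this. -/
theorem ext_of_relTrace [CompactSpace X] [TotallySeparatedSpace X] {R S : FullClosedRel X}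
    (h : ∀ Q : DiscreteQuotient X, relTrace Q.proj R.1 = relTrace Q.proj S.1) : R = S := by
  have key : ∀ R S : FullClosedRel X,
      (∀ Q : DiscreteQuotient X, relTrace Q.proj R.1 = relTrace Q.proj S.1) → R.1 ⊆ S.1 := by
    rintro R S h ⟨x, y⟩ hxy
    by_contra hn
    obtain ⟨Q, hQ⟩ := (isCompact_singleton (x := (x, y))).exists_discreteQuotient_box
      S.2.1.isOpen_compl (singleton_subset_iff.2 hn)
    obtain ⟨x', y', hS, hx, hy⟩ := mem_relTrace.1 (h Q ▸ mk_mem_relTrace hxy)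
    exact hQ x y x' y' rfl hx hy hS
  exact Subtype.ext (Subset.antisymm (key R S h) (key S R fun Q => (h Q).symm))

theorem isOpen_inter_nonempty {U : Set (X × X)} (hU : IsOpen U) :
    IsOpen {R : FullClosedRel X | (R.1 ∩ U).Nonempty} :=
  ⟨_, TopologicalSpace.vietoris.isOpen_inter_nonempty_of_isOpen hU, rfl⟩

theorem isOpen_subset {U : Set (X × X)} (hU : IsOpen U) :
    IsOpen {R : FullClosedRel X | R.1 ⊆ U} :=
  ⟨_, hU.powerset_vietoris, rfl⟩

/-- There are finitely many boxes and each is clopen, so meeting a box and missing it are both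
Vietoris-open conditions. -/
theorem isLocallyConstant_relTrace [CompactSpace X] (Q : DiscreteQuotient X) :
    IsLocallyConstant fun R : FullClosedRel X => relTrace Q.proj R.1 := by
  rw [IsLocallyConstant.iff_eventually_eq]
  intro R
  have h1 : ∀ p : Q × Q, ∀ᶠ S : FullClosedRel X in 𝓝 R,
      (p ∈ relTrace Q.proj S.1 ↔ p ∈ relTrace Q.proj R.1) := by
    rintro p
    have hcl : IsClopen (Prod.map Q.proj Q.proj ⁻¹' {p} : Set (X × X)) :=
      (isClopen_discrete {p}).preimage (Q.proj_continuous.prodMap Q.proj_continuous)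
    by_cases hp : p ∈ relTrace Q.proj R.1
    · have : R ∈ {S : FullClosedRel X | (S.1 ∩ Prod.map Q.proj Q.proj ⁻¹' {p}).Nonempty} := hp
      filter_upwards [(isOpen_inter_nonempty hcl.isOpen).mem_nhds this] with S hS
      exact ⟨fun _ => hp, fun _ => hS⟩
    · have : R ∈ {S : FullClosedRel X | S.1 ⊆ (Prod.map Q.proj Q.proj ⁻¹' {p})ᶜ} :=
        fun q hq hqp => hp ⟨q, hq, hqp⟩
      filter_upwards [(isOpen_subset hcl.compl.isOpen).mem_nhds this] with S hS
      refine ⟨fun h => ?_, fun h => absurd h hp⟩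
      obtain ⟨q, hq, hqp⟩ := h
      exact absurd hqp (hS hq)
  filter_upwards [eventually_all.2 h1] with S hS
  exact Set.ext hS

/-- The uniformity of `E₀(X)` given by the traces on discrete quotients. It induces the Vietoris
topology. -/
theorem toTopologicalSpace_iInf_relTrace [CompactSpace X] [TotallySeparatedSpace X] :
    instTopologicalSpace (X := X) =
    (⨅ Q : DiscreteQuotient X, UniformSpace.comap
      (fun R : FullClosedRel X => relTrace Q.proj R.1) ⊥).toTopologicalSpace := by
  rw [UniformSpace.toTopologicalSpace_iInf]
  apply le_antisymm
  · refine le_iInf fun Q => ?_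
    rw [UniformSpace.toTopologicalSpace_comap, UniformSpace.toTopologicalSpace_bot]
    rintro _ ⟨s, -, rfl⟩
    exact isLocallyConstant_relTrace Q s
  -- It remains to see that the subbasic Vietoris sets are open for traces: near each of their
  -- members, one trace decides membership.
  · have key : ∀ s : Set (FullClosedRel X), (∀ R ∈ s, ∃ Q : DiscreteQuotient X,
        ∀ S : FullClosedRel X, relTrace Q.proj S.1 = relTrace Q.proj R.1 → S ∈ s) →
        IsOpen[⨅ Q : DiscreteQuotient X, (UniformSpace.comap
          (fun R : FullClosedRel X => relTrace Q.proj R.1) ⊥).toTopologicalSpace] s := by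
      intro s hs
      rw [@isOpen_iff_forall_mem_open]
      intro R hR
      obtain ⟨Q, hQ⟩ := hs R hR
      exact ⟨{S | relTrace Q.proj S.1 = relTrace Q.proj R.1}, hQ,
        iInf_le (fun Q : DiscreteQuotient X => (UniformSpace.comap
          (fun R : FullClosedRel X => relTrace Q.proj R.1) ⊥).toTopologicalSpace) Q _
          ⟨{relTrace Q.proj R.1}, trivial, rfl⟩, rfl⟩
    refine le_trans (le_generateFrom ?_) induced_generateFrom_eq.ge
    rintro _ ⟨_, ⟨U, hU, rfl⟩ | ⟨U, hU, rfl⟩, rfl⟩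
    · refine key _ fun R hR => ?_
      obtain ⟨Q, hQ⟩ := R.2.1.isCompact.exists_discreteQuotient_box hU hR
      refine ⟨Q, fun S hS => ?_⟩
      rintro ⟨x', y'⟩ hxy
      obtain ⟨x, y, hR, hx, hy⟩ := mem_relTrace.1 (hS ▸ mk_mem_relTrace hxy)
      exact hQ x y x' y' hR hx.symm hy.symm
    · refine key _ ?_
      rintro R ⟨⟨x, y⟩, hR, hxyU⟩
      obtain ⟨Q, hQ⟩ := (isCompact_singleton (x := (x, y))).exists_discreteQuotient_box
        hU (singleton_subset_iff.2 hxyU)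
      refine ⟨Q, fun S hS => ?_⟩
      obtain ⟨x', y', hS', hx, hy⟩ := mem_relTrace.1 (hS.symm ▸ mk_mem_relTrace hR)
      exact ⟨(x', y'), hS', hQ x y x' y' rfl hx hy⟩

/-- The uniformity of `E₀(X)`, generated by the traces on discrete quotients. -/
@[reducible]
def traceUniformSpace (X : Type*) [TopologicalSpace X] [CompactSpace X]
    [TotallySeparatedSpace X] : UniformSpace (FullClosedRel X) :=
  (⨅ Q : DiscreteQuotient X, UniformSpace.comap
    (fun R : FullClosedRel X => relTrace Q.proj R.1) ⊥).replaceTopology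
      toTopologicalSpace_iInf_relTrace

theorem hasBasis_uniformity [CompactSpace X] [TotallySeparatedSpace X] :
    (@uniformity _ (traceUniformSpace X)).HasBasis (fun _ : DiscreteQuotient X => True)
      fun Q => {p | relTrace Q.proj p.1.1 = relTrace Q.proj p.2.1} := by
  have h : @uniformity _ (traceUniformSpace X) = ⨅ Q : DiscreteQuotient X,
      𝓟 {p : FullClosedRel X × FullClosedRel X |
        relTrace Q.proj p.1.1 = relTrace Q.proj p.2.1} := by
    change @uniformity _ (⨅ Q : DiscreteQuotient X, UniformSpace.comap
      (fun R : FullClosedRel X => relTrace Q.proj R.1) ⊥) = _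
    rw [iInf_uniformity]
    refine iInf_congr fun Q => ?_
    rw [uniformity_comap, bot_uniformity, comap_principal]
    rfl
  rw [h]
  refine hasBasis_iInf_principal fun P Q => ⟨P ⊓ Q, ?_, ?_⟩
  · exact fun p hp => relTrace_eq_of_le inf_le_left hp
  · exact fun p hp => relTrace_eq_of_le inf_le_right hp

instance [CompactSpace X] [TotallySeparatedSpace X] : T2Space (FullClosedRel X) := by
  refine ⟨fun R S hRS => ?_⟩
  obtain ⟨Q, hQ⟩ : ∃ Q : DiscreteQuotient X, relTrace Q.proj R.1 ≠ relTrace Q.proj S.1 := by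
    by_contra! h
    exact hRS (ext_of_relTrace h)
  exact ⟨_, _, (isLocallyConstant_relTrace Q).isOpen_fiber _,
    (isLocallyConstant_relTrace Q).isOpen_fiber _, rfl, rfl,
    disjoint_left.2 fun T h1 h2 => hQ (h1.symm.trans h2)⟩

-- An ultrafilter converges in the compact hyperspace of all subsets, and its limit may be replaced
-- by the closure. Meeting a closed set passes to the limit; applied to the fibres of both
-- projections, this keeps domain and range full.
attribute [local instance] TopologicalSpace.vietoris in
instance [CompactSpace X] [T2Space X] : CompactSpace (FullClosedRel X) := by
  refine ⟨isCompact_iff_ultrafilter_le_nhds.2 fun 𝒰 _ => ?_⟩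
  obtain ⟨A, -, hA⟩ := (isCompact_univ (X := Set (X × X))).ultrafilter_le_nhds
    (𝒰.map Subtype.val) (by simp)
  have hA' : Tendsto (fun R : FullClosedRel X => R.1) 𝒰 (𝓝 (closure A)) :=
    hA.trans (TopologicalSpace.vietoris.specializes_of_subset_closure subset_closure Subset.rfl)
  have hmem : ∀ F : Set (X × X), IsClosed F → (∀ R : FullClosedRel X, (R.1 ∩ F).Nonempty) →
      (closure A ∩ F).Nonempty := by
    intro F hF h
    have hcl := TopologicalSpace.vietoris.isClosed_inter_nonempty_of_isClosed hF
    exact hcl.mem_of_tendsto hA' (Eventually.of_forall h)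
  refine ⟨⟨closure A, isClosed_closure, ?_, ?_⟩, trivial, ?_⟩
  · refine eq_univ_of_forall fun x => ?_
    obtain ⟨⟨a, b⟩, hab, ha⟩ := hmem (Prod.fst ⁻¹' {x}) (isClosed_singleton.preimage continuous_fst)
      fun R => let ⟨y, hy⟩ := R.exists_mem_left x; ⟨(x, y), hy, rfl⟩
    exact ⟨b, (show a = x from ha) ▸ hab⟩
  · refine eq_univ_of_forall fun x => ?_
    obtain ⟨⟨a, b⟩, hab, ha⟩ := hmem (Prod.snd ⁻¹' {x}) (isClosed_singleton.preimage continuous_snd)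
      fun R => let ⟨y, hy⟩ := R.exists_mem_right x; ⟨(y, x), hy, rfl⟩
    exact ⟨a, (show b = x from ha) ▸ hab⟩
  · exact (map_le_iff_le_comap.1 hA').trans (nhds_induced _ _).ge

end FullClosedRel

/-! ### Traces of self-homeomorphisms -/

section Trace

variable {X : Type*} [TopologicalSpace X] [CompactSpace X] [T2Space X]

/-- The double coset of a self-homeomorphism with respect to the stabilizer of a colouring is
determined by the trace of its graph. -/
theorem IsHHomogeneous.exists_eq_mul_of_relTrace_eq (hX : IsHHomogeneous X) {ι : Type*} {c : X → ι}
    (hc : IsLocallyConstant c) {g h : X ≃ₜ X}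
    (hgh : relTrace c (FullClosedRel.graph g).1 = relTrace c (FullClosedRel.graph h).1) :
    ∃ a b : X ≃ₜ X, (∀ x, c (a x) = c x) ∧ (∀ x, c (b x) = c x) ∧ h = b * g * a := by
  rw [relTrace_graph, relTrace_graph] at hgh
  -- The trace is the range of `x ↦ (c x, c (g x))`, so these colourings for `h` and `g` have the
  -- same colours. The matching `e` serves as `a`, and `b` is then forced.
  obtain ⟨e, he⟩ := hX.exists_homeomorph
    (hc.prodMk (hc.comp_continuous h.continuous)) (hc.prodMk (hc.comp_continuous g.continuous))
    hgh.symm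
  simp only [Prod.mk.injEq, Function.comp_apply] at he
  refine ⟨e, h * e⁻¹ * g⁻¹, fun x => (he x).1, fun x => ?_, by group⟩
  have := (he (e⁻¹ (g⁻¹ x))).2
  simp only [← Homeomorph.mul_apply, mul_inv_cancel, mul_inv_cancel_left, mul_assoc] at this ⊢
  simpa using this.symm

/-- Between two self-homeomorphisms one may insert an element of the stabilizer of a colouring
such that the trace of the product contains the composition of the traces. -/
theorem IsHHomogeneous.exists_comp_relTrace_subset [Nontrivial X] (hX : IsHHomogeneous X)
    {ι : Type*} {c : X → ι} (hc : IsLocallyConstant c) (g h : X ≃ₜ X) :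
    ∃ v : X ≃ₜ X, (∀ x, c (v x) = c x) ∧
      ∀ x y, c (h x) = c y → ∃ w, c w = c x ∧ c ((g * v * h) w) = c (g y) := by
  -- Triples (middle, source, target) of colours. Each cell is cut into one piece per triple with
  -- that middle colour, once by where `h` comes from and once by where `g` goes; `v` matches the
  -- pieces.
  let T : Set (ι × ι × ι) := {p | (∃ x, c x = p.2.1 ∧ c (h x) = p.1) ∧
    ∃ y, c y = p.1 ∧ c (g y) = p.2.2}
  have hT : Finite T := by
    refine ((hc.range_finite.prod (hc.range_finite.prod hc.range_finite)).subset ?_).to_subtype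
    rintro ⟨i, j, k⟩ ⟨⟨x, rfl, rfl⟩, ⟨y, -, rfl⟩⟩
    exact ⟨⟨_, rfl⟩, ⟨_, rfl⟩, ⟨_, rfl⟩⟩
  obtain ⟨a, ha, has, hac⟩ := hX.exists_refinement (T := T)
    (c := fun x => (c x, c (h⁻¹ x)))
    (hc.prodMk (hc.comp_continuous (h⁻¹).continuous)) (r := fun p => (p.1.1, p.1.2.1)) (by
      ext ⟨i, j⟩
      constructor
      · rintro ⟨⟨⟨i, j, k⟩, ⟨x, hx, hx'⟩, _⟩, hp⟩
        exact ⟨h x, Prod.ext (hx'.trans (Prod.mk.inj hp).1)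
          ((congrArg c (h.symm_apply_apply x)).trans (hx.trans (Prod.mk.inj hp).2))⟩
      · rintro ⟨x, hx⟩
        simp only [Prod.mk.injEq] at hx
        exact ⟨⟨(i, j, c (g x)), ⟨h⁻¹ x, hx.2, by simpa using hx.1⟩, ⟨x, hx.1, rfl⟩⟩, rfl⟩)
  obtain ⟨b, hb, hbs, hbc⟩ := hX.exists_refinement (T := T)
    (c := fun x => (c x, c (g x)))
    (hc.prodMk (hc.comp_continuous g.continuous)) (r := fun p => (p.1.1, p.1.2.2)) (by
      ext ⟨i, j⟩
      constructor
      · rintro ⟨⟨⟨i, j, k⟩, _, ⟨x, hx, hx'⟩⟩, hp⟩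
        exact ⟨x, Prod.ext (hx.trans (Prod.mk.inj hp).1) (hx'.trans (Prod.mk.inj hp).2)⟩
      · rintro ⟨x, hx⟩
        simp only [Prod.mk.injEq] at hx
        exact ⟨⟨(i, c (h⁻¹ x), j), ⟨h⁻¹ x, rfl, by simpa using hx.1⟩, ⟨x, hx⟩⟩, rfl⟩)
  simp only [Prod.mk.injEq] at hac hbc
  obtain ⟨v, hv⟩ := hX.exists_homeomorph ha hb (by rw [has.range_eq, hbs.range_eq])
  refine ⟨v, fun x => ?_, fun x y hxy => ?_⟩
  · rw [← (hbc _).1, hv, (hac _).1]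
  · obtain ⟨w, hw⟩ := has ⟨(c y, c x, c (g y)), ⟨x, rfl, hxy⟩, ⟨y, rfl, rfl⟩⟩
    refine ⟨h⁻¹ w, ?_, ?_⟩
    · rw [← (hac w).2, hw]
    · have : (g * v * h) (h⁻¹ w) = g (v w) := by simp [Homeomorph.mul_apply]
      rw [this, ← (hbc _).2, hv, hw]

/-- Every relation in `E₀(X)` has the same trace as a self-homeomorphism. -/
theorem IsHHomogeneous.exists_relTrace_graph_eq [Nontrivial X] (hX : IsHHomogeneous X)
    {ι : Type*} {c : X → ι} (hc : IsLocallyConstant c) (R : FullClosedRel X) :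
    ∃ g : X ≃ₜ X, relTrace c (FullClosedRel.graph g).1 = relTrace c R.1 := by
  have hT : Finite (relTrace c R.1) := by
    refine ((hc.range_finite.prod hc.range_finite).subset ?_).to_subtype
    rintro _ ⟨⟨x, y⟩, -, rfl⟩
    exact ⟨⟨_, rfl⟩, ⟨_, rfl⟩⟩
  -- Source and target cells are cut into pieces indexed by the pairs of the trace, and `g` matches
  -- the pieces. Full domain and range ensure that each cell receives an index.
  obtain ⟨a, ha, has, hac⟩ := hX.exists_refinement (T := relTrace c R.1) hc
    (r := fun p => p.1.1) (by
      ext i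
      constructor
      · rintro ⟨⟨_, ⟨x, y⟩, -, rfl⟩, rfl⟩
        exact ⟨x, rfl⟩
      · rintro ⟨x, rfl⟩
        obtain ⟨y, hy⟩ := R.exists_mem_left x
        exact ⟨⟨_, mk_mem_relTrace hy⟩, rfl⟩)
  obtain ⟨b, hb, hbs, hbc⟩ := hX.exists_refinement (T := relTrace c R.1) hc
    (r := fun p => p.1.2) (by
      ext i
      constructor
      · rintro ⟨⟨_, ⟨x, y⟩, -, rfl⟩, rfl⟩
        exact ⟨y, rfl⟩
      · rintro ⟨y, rfl⟩
        obtain ⟨x, hx⟩ := R.exists_mem_right y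
        exact ⟨⟨_, mk_mem_relTrace hx⟩, rfl⟩)
  obtain ⟨g, hg⟩ := hX.exists_homeomorph ha hb (by rw [has.range_eq, hbs.range_eq])
  refine ⟨g, ?_⟩
  rw [relTrace_graph]
  have : (fun x => (c x, c (g x))) = Subtype.val ∘ a := by
    funext x
    rw [← hac x, ← hbc (g x), hg x]
    rfl
  rw [this, has.range_comp, Subtype.range_coe]

end Trace

/-! ### Neighbourhoods of the identity -/

section Nhds

variable {X : Type*} [TopologicalSpace X] [CompactSpace X]

theorem Aut.setOf_stabilizes_mem_nhds_one {ι : Type*} {c : X → ι} (hc : IsLocallyConstant c) :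
    {g : X ≃ₜ X | ∀ x, c (g x) = c x} ∈ 𝓝 (1 : X ≃ₜ X) := by
  have hfin : Finite (range c) := hc.range_finite
  have h : ∀ i : range c, ∀ᶠ g : X ≃ₜ X in 𝓝 1,
      MapsTo (g : C(X, X)) {x | c x = i.1} {x | c x = i.1} := fun i =>
    (ContinuousMap.tendsto_nhds_compactOpen.1 (Aut.isInducing_coe.continuous.tendsto 1)) _
      (hc.isClosed_fiber i.1).isCompact _ (hc.isOpen_fiber i.1) fun x hx => hx
  filter_upwards [eventually_all.2 h] with g hg x
  exact hg ⟨c x, x, rfl⟩ rfl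

theorem Aut.hasBasis_nhds_one [TotallySeparatedSpace X] :
    (𝓝 (1 : X ≃ₜ X)).HasBasis (fun _ : DiscreteQuotient X => True)
      fun Q => {g | ∀ x, Q.proj (g x) = Q.proj x} := by
  have h : 𝓝 (1 : X ≃ₜ X) = ⨅ Q : DiscreteQuotient X,
      𝓟 {g : X ≃ₜ X | ∀ x, Q.proj (g x) = Q.proj x} := by
    apply le_antisymm
    · exact le_iInf fun Q => le_principal_iff.2
        (Aut.setOf_stabilizes_mem_nhds_one Q.proj_isLocallyConstant)
    · rw [Aut.isInducing_coe.nhds_eq_comap, ← map_le_iff_le_comap]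
      refine ContinuousMap.tendsto_nhds_compactOpen.2 fun K hK U hU hKU => ?_
      have hKU' : K ⊆ U := hKU
      -- The box lemma for `X × X` is used only on the diagonal of `K × K`.
      obtain ⟨Q, hQ⟩ := (hK.prod hK).exists_discreteQuotient_box (hU.prod hU)
        (prod_mono hKU' hKU')
      refine mem_of_superset (mem_iInf_of_mem Q (mem_principal_self _)) fun g hg x hx => ?_
      exact (hQ x x (g x) (g x) ⟨hx, hx⟩ (hg x) (hg x)).1
  rw [h]
  refine hasBasis_iInf_principal fun P Q => ⟨P ⊓ Q, ?_, ?_⟩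
  · exact fun g hg x => DiscreteQuotient.proj_eq_of_le inf_le_left (hg x)
  · exact fun g hg x => DiscreteQuotient.proj_eq_of_le inf_le_right (hg x)

instance Aut.instT2Space [T2Space X] : T2Space (X ≃ₜ X) :=
  T2Space.of_injective_continuous (f := fun f : X ≃ₜ X => (f : C(X, X)))
    (fun _ _ h => Homeomorph.ext fun x => DFunLike.congr_fun (F := C(X, X)) h x)
    Aut.isInducing_coe.continuous

end Nhds

/-! ### Relations that are graphs -/

section Graph

variable {X : Type*} [TopologicalSpace X] [CompactSpace X] [T2Space X]

/-- A closed relation that is functional in both directions is the graph of a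
self-homeomorphism. -/
theorem FullClosedRel.exists_graph_eq {R : FullClosedRel X}
    (h1 : ∀ x y z, (x, y) ∈ R.1 → (x, z) ∈ R.1 → y = z)
    (h2 : ∀ x y z, (x, z) ∈ R.1 → (y, z) ∈ R.1 → x = y) : ∃ g, FullClosedRel.graph g = R := by
  choose f hf using R.exists_mem_left
  choose f' hf' using R.exists_mem_right
  let E : X ≃ X := ⟨f, f', fun x => h2 _ _ _ (hf' _) (hf x), fun y => h1 _ _ _ (hf _) (hf' y)⟩
  have hcont : Continuous E := by
    -- Closed graph argument: the preimage of a closed set is a projection of a closed set along a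
    -- compact factor.
    refine continuous_iff_isClosed.2 fun F hF => ?_
    have : E ⁻¹' F = Prod.fst '' (R.1 ∩ Prod.snd ⁻¹' F) := by
      ext x
      constructor
      · exact fun hx => ⟨(x, f x), ⟨hf x, hx⟩, rfl⟩
      · rintro ⟨⟨x, y⟩, ⟨hxy, hy⟩, rfl⟩
        exact (h1 _ _ _ hxy (hf x)) ▸ hy
    rw [this]
    exact isClosedMap_fst_of_compactSpace _ (R.2.1.inter (hF.preimage continuous_snd))
  refine ⟨hcont.homeoOfEquivCompactToT2, Subtype.ext (Set.ext fun ⟨x, y⟩ => ?_)⟩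
  constructor
  · rintro (rfl : f x = y)
    exact hf x
  · exact fun h => h1 _ _ _ (hf x) h

theorem FullClosedRel.graphHom_injective :
    Function.Injective (FullClosedRel.graphHom X) := by
  intro f g h
  refine Homeomorph.ext fun x => ?_
  have : (x, f x) ∈ (FullClosedRel.graphHom X g).1 := h ▸ (rfl : f x = f x)
  exact Eq.symm this

/-- If `S` is the inverse of `R`, then any `w` with `(w, x) ∈ S` equals every `R`-value of `x`, so
`R` is single-valued; the other direction is symmetric. -/
theorem FullClosedRel.range_graphHom :
    range (FullClosedRel.graphHom X) = {R : FullClosedRel X | IsUnit R} := by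
  ext R
  constructor
  · rintro ⟨g, rfl⟩
    exact (Group.isUnit g).map _
  · intro hR
    obtain ⟨S, hRS, hSR⟩ := isUnit_iff_exists.1 hR
    have k1 : ∀ x y z, (x, z) ∈ S.1 → (z, y) ∈ R.1 → x = y := fun x y z h h' => by
      have : (x, y) ∈ (R * S).1 := ⟨z, h, h'⟩
      rw [hRS] at this
      exact this
    have k2 : ∀ x y z, (x, z) ∈ R.1 → (z, y) ∈ S.1 → x = y := fun x y z h h' => by
      have : (x, y) ∈ (S * R).1 := ⟨z, h, h'⟩
      rw [hSR] at this
      exact this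
    refine FullClosedRel.exists_graph_eq (fun x y z hy hz => ?_) fun x y z hx hy => ?_
    · obtain ⟨w, hw⟩ := S.exists_mem_right x
      exact (k1 _ _ _ hw hy).symm.trans (k1 _ _ _ hw hz)
    · obtain ⟨w, hw⟩ := S.exists_mem_left z
      exact (k2 _ _ _ hx hw).trans (k2 _ _ _ hy hw).symm

end Graph

/-! ### The Roelcke completion -/

section Roelcke

variable {X : Type*} [TopologicalSpace X] [CompactSpace X] [T2Space X]

/-- The Roelcke uniformity of `Aut X` is induced from `E₀(X)` by graphs. -/
theorem IsHHomogeneous.isUniformInducing_graph [TotallySeparatedSpace X] (hX : IsHHomogeneous X) :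
    @IsUniformInducing (X ≃ₜ X) (FullClosedRel X) (roelckeUniformSpace (X ≃ₜ X))
      (FullClosedRel.traceUniformSpace X) FullClosedRel.graph := by
  let uR := roelckeUniformSpace (X ≃ₜ X)
  let uE := FullClosedRel.traceUniformSpace X
  have hl : 𝓤[IsTopologicalGroup.leftUniformSpace (X ≃ₜ X)] =
    comap (fun x : (X ≃ₜ X) × (X ≃ₜ X) => x.1⁻¹ * x.2) (𝓝 1) := rfl
  have hr : 𝓤[IsTopologicalGroup.rightUniformSpace (X ≃ₜ X)] =
    comap (fun x : (X ≃ₜ X) × (X ≃ₜ X) => x.2 * x.1⁻¹) (𝓝 1) := rfl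
  have hcomap := FullClosedRel.hasBasis_uniformity (X := X).comap
    (Prod.map FullClosedRel.graph FullClosedRel.graph : (X ≃ₜ X) × (X ≃ₜ X) → _)
  refine ⟨le_antisymm ?_ ?_⟩
  · intro E hE
    obtain ⟨E', hE', hEE⟩ := comp_mem_uniformity_sets hE
    have hEl : E' ∈ 𝓤[IsTopologicalGroup.leftUniformSpace (X ≃ₜ X)] :=
      (le_sup_left : IsTopologicalGroup.leftUniformSpace (X ≃ₜ X) ≤ uR) hE'
    have hEr : E' ∈ 𝓤[IsTopologicalGroup.rightUniformSpace (X ≃ₜ X)] :=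
      (le_sup_right : IsTopologicalGroup.rightUniformSpace (X ≃ₜ X) ≤ uR) hE'
    rw [hl] at hEl
    rw [hr] at hEr
    obtain ⟨P, -, hP⟩ := (Aut.hasBasis_nhds_one.comap _).mem_iff.1 hEl
    obtain ⟨Q, -, hQ⟩ := (Aut.hasBasis_nhds_one.comap _).mem_iff.1 hEr
    refine hcomap.mem_iff.2 ⟨P ⊓ Q, trivial, ?_⟩
    rintro ⟨g, h⟩ hgh
    obtain ⟨a, b, ha, hb, rfl⟩ :=
      hX.exists_eq_mul_of_relTrace_eq (P ⊓ Q).proj_isLocallyConstant hgh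
    -- Passing from `g` to `g * a` is small on the left, and from `g * a` to `b * g * a` on the
    -- right.
    refine hEE ⟨g * a, hP ?_, hQ ?_⟩
    · intro x
      change P.proj ((g⁻¹ * (g * a)) x) = _
      rw [inv_mul_cancel_left]
      exact DiscreteQuotient.proj_eq_of_le inf_le_left (ha x)
    · intro x
      change Q.proj ((b * g * a * (g * a)⁻¹) x) = _
      rw [mul_assoc b, mul_inv_cancel_right]
      exact DiscreteQuotient.proj_eq_of_le inf_le_right (hb x)
  -- Conversely, multiplying on either side by a stabilizing element does not change the trace.
  · have key : uR ≤ uE.comap FullClosedRel.graph := by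
      refine sup_le ?_ ?_
      · rw [UniformSpace.le_def, uniformity_comap, hl]
        refine hcomap.ge_iff.2 fun Q _ => mem_comap.2
          ⟨_, Aut.setOf_stabilizes_mem_nhds_one Q.proj_isLocallyConstant, ?_⟩
        rintro ⟨g, h⟩ hgh
        have := FullClosedRel.relTrace_graph_mul_right hgh g
        rw [mul_inv_cancel_left] at this
        exact this.symm
      · rw [UniformSpace.le_def, uniformity_comap, hr]
        refine hcomap.ge_iff.2 fun Q _ => mem_comap.2
          ⟨_, Aut.setOf_stabilizes_mem_nhds_one Q.proj_isLocallyConstant, ?_⟩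
        rintro ⟨g, h⟩ hgh
        have := FullClosedRel.relTrace_graph_mul_left hgh g
        rw [inv_mul_cancel_right] at this
        exact this.symm
    rw [UniformSpace.le_def, uniformity_comap] at key
    exact key

instance FullClosedRel.instSubsingleton [Subsingleton X] : Subsingleton (FullClosedRel X) := by
  have key : ∀ R : FullClosedRel X, R.1 = univ := by
    intro R
    refine eq_univ_of_forall fun ⟨x, y⟩ => ?_
    obtain ⟨z, hz⟩ := R.exists_mem_left x
    exact Subsingleton.elim z y ▸ hz
  exact ⟨fun R S => Subtype.ext ((key R).trans (key S).symm)⟩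

theorem IsHHomogeneous.denseRange_graph (hX : IsHHomogeneous X) :
    DenseRange (FullClosedRel.graph : (X ≃ₜ X) → FullClosedRel X) := by
  rcases subsingleton_or_nontrivial X with h | h
  · exact fun R => subset_closure ⟨1, Subsingleton.elim _ _⟩
  have := hX.totallySeparatedSpace
  let uE := FullClosedRel.traceUniformSpace X
  intro R
  refine (mem_closure_iff_nhds_basis
    (nhds_basis_uniformity FullClosedRel.hasBasis_uniformity)).2 fun Q _ => ?_
  obtain ⟨g, hg⟩ := hX.exists_relTrace_graph_eq Q.proj_isLocallyConstant R
  exact ⟨_, ⟨g, rfl⟩, hg⟩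

theorem IsHHomogeneous.isRoelckePrecompact (hX : IsHHomogeneous X) :
    IsRoelckePrecompact (X ≃ₜ X) := by
  have := hX.totallySeparatedSpace
  let uE := FullClosedRel.traceUniformSpace X
  have h := @totallyBounded_preimage _ _ (roelckeUniformSpace (X ≃ₜ X)) uE _ _
    hX.isUniformInducing_graph (isCompact_univ (X := FullClosedRel X)).totallyBounded
  exact h

attribute [local instance] AbstractCompletion.uniformStruct in
/-- The Roelcke completion of `Aut X` is `E₀(X)`. -/
theorem IsHHomogeneous.exists_homeomorph_roelckeCompletion (hX : IsHHomogeneous X) :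
    ∃ Φ : RoelckeCompletion (X ≃ₜ X) ≃ₜ FullClosedRel X,
      ∀ g : X ≃ₜ X, Φ (RoelckeCompletion.of g) = FullClosedRel.graph g := by
  have := hX.totallySeparatedSpace
  let uR := roelckeUniformSpace (X ≃ₜ X)
  let uE := FullClosedRel.traceUniformSpace X
  -- `E₀(X)` is complete, being compact, and contains the graphs densely; uniqueness of completions
  -- does the rest.
  let pkg : @AbstractCompletion (X ≃ₜ X) uR := @AbstractCompletion.mk _ uR (FullClosedRel X)
    FullClosedRel.graph uE inferInstance inferInstance hX.isUniformInducing_graph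
    hX.denseRange_graph
  exact ⟨((@UniformSpace.Completion.cPkg _ uR).compareEquiv pkg).toHomeomorph,
    fun g => (@UniformSpace.Completion.cPkg _ uR).compare_coe pkg g⟩

end Roelcke

/-! ### Continuous homomorphisms of `Aut X` -/

section Hom

variable {X : Type*} [TopologicalSpace X]

/-- A self-homeomorphism links `x` to `y` with respect to a colouring if it takes some point of the
colour of `x` to a point of the colour of `y`. -/
def Links {ι : Type*} (c : X → ι) (g : X ≃ₜ X) (x y : X) : Prop :=
  ∃ w, c w = c x ∧ c (g w) = c y

theorem Links.inv {ι : Type*} {c : X → ι} {g : X ≃ₜ X} {x y : X} (h : Links c g x y) :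
    Links c g⁻¹ y x := by
  obtain ⟨w, hx, hy⟩ := h
  exact ⟨g w, hy, (congrArg c (g.symm_apply_apply w)).trans hx⟩

theorem Links.of_le {P Q : DiscreteQuotient X} (hPQ : P ≤ Q) {g : X ≃ₜ X} {x y : X}
    (h : Links P.proj g x y) : Links Q.proj g x y := by
  obtain ⟨w, hx, hy⟩ := h
  exact ⟨w, DiscreteQuotient.proj_eq_of_le hPQ hx, DiscreteQuotient.proj_eq_of_le hPQ hy⟩

theorem links_iff_mem_relTrace [T2Space X] {ι : Type*} {c : X → ι} {g : X ≃ₜ X} {x y : X} :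
    Links c g x y ↔ (c x, c y) ∈ relTrace c (FullClosedRel.graph g).1 :=
  mem_relTrace_graph.symm

theorem relTrace_graph_eq_univ [T2Space X] {Q : DiscreteQuotient X} {g : X ≃ₜ X}
    (h : ∀ a b, Links Q.proj g a b) : relTrace Q.proj (FullClosedRel.graph g).1 = univ := by
  refine eq_univ_of_forall fun ⟨i, j⟩ => ?_
  obtain ⟨a, rfl⟩ := Q.proj_surjective i
  obtain ⟨b, rfl⟩ := Q.proj_surjective j
  exact links_iff_mem_relTrace.1 (h a b)

/-- Links need not compose, as they may use different points of the middle cell. One stabilizing `v`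
repairs this for all links at once. -/
theorem IsHHomogeneous.exists_links_comp [CompactSpace X] [T2Space X] [Nontrivial X]
    (hX : IsHHomogeneous X) {ι : Type*} {c : X → ι} (hc : IsLocallyConstant c) (g h : X ≃ₜ X) :
    ∃ v : X ≃ₜ X, (∀ x, c (v x) = c x) ∧
      ∀ x y z, Links c h x y → Links c g y z → Links c (g * v * h) x z := by
  obtain ⟨v, hv, hvl⟩ := hX.exists_comp_relTrace_subset hc g h
  refine ⟨v, hv, ?_⟩
  rintro x y z ⟨a, hax, hay⟩ ⟨b, hby, hbz⟩
  obtain ⟨w, hw, hw'⟩ := hvl a b (hay.trans hby.symm)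
  exact ⟨w, hw.trans hax, hw'.trans hbz⟩

variable {H : Type*} [Group H] [TopologicalSpace H]

/-- Two points are nearly linked by a homomorphism `φ` if, for every discrete quotient, some
self-homeomorphisms with `φ`-images arbitrarily close to `1` link the first point to the second
one and every point to itself. -/
def NearlyLinked (φ : (X ≃ₜ X) →* H) (x y : X) : Prop :=
  ∀ (Q : DiscreteQuotient X), ∀ W ∈ 𝓝 (1 : H), ∃ g, φ g ∈ W ∧
    (∀ a, Links Q.proj g a a) ∧ Links Q.proj g x y

/-- This makes the inserted stabilizing elements harmless: their images are small. -/
theorem Aut.exists_le_stabilizer_mem {φ : (X ≃ₜ X) →* H} [CompactSpace X] [TotallySeparatedSpace X]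
    (hφ : Continuous φ)
    (Q : DiscreteQuotient X) {W : Set H} (hW : W ∈ 𝓝 (1 : H)) :
    ∃ P ≤ Q, ∀ v : X ≃ₜ X, (∀ x, P.proj (v x) = P.proj x) → φ v ∈ W := by
  have h : φ ⁻¹' W ∈ 𝓝 (1 : X ≃ₜ X) := hφ.continuousAt.preimage_mem_nhds (by rwa [map_one])
  obtain ⟨P, -, hP⟩ := Aut.hasBasis_nhds_one.mem_iff.1 h
  exact ⟨P ⊓ Q, inf_le_right, fun v hv =>
    hP fun x => DiscreteQuotient.proj_eq_of_le inf_le_left (hv x)⟩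

theorem exists_symm_nhds_one_split4 [IsTopologicalGroup H] {W : Set H} (hW : W ∈ 𝓝 (1 : H)) :
    ∃ V ∈ 𝓝 (1 : H), (∀ v ∈ V, v⁻¹ ∈ V) ∧
      ∀ a ∈ V, ∀ b ∈ V, ∀ c ∈ V, ∀ d ∈ V, a * b * c * d ∈ W := by
  obtain ⟨V, hV, h⟩ := exists_nhds_one_split4 hW
  refine ⟨V ∩ V⁻¹, inter_mem hV (inv_mem_nhds_one H hV), fun v hv => ⟨hv.2, by simpa using hv.1⟩,
    fun a ha b hb c hc d hd => h ha.1 hb.1 hc.1 hd.1⟩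

variable [IsTopologicalGroup H] {φ : (X ≃ₜ X) →* H}

/-- Conjugation by `f` preserves closeness of images to 1 and transports links; the partition is
pulled back along `f`. -/
theorem NearlyLinked.map {x y : X} (h : NearlyLinked φ x y) (f : X ≃ₜ X) :
    NearlyLinked φ (f x) (f y) := by
  intro Q W hW
  have hcont : Tendsto (fun w => φ f * w * (φ f)⁻¹) (𝓝 1) (𝓝 1) := by
    have : Continuous fun w => φ f * w * (φ f)⁻¹ := by fun_prop
    simpa using this.tendsto 1
  obtain ⟨g, hgW, hgd, hg⟩ := h (Q.comap (f : C(X, X))) _ (hcont hW)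
  have key : ∀ a b, Links (Q.comap (f : C(X, X))).proj g a b →
      Links Q.proj (f * g * f⁻¹) (f a) (f b) := by
    rintro a b ⟨w, hw, hw'⟩
    have h1 : Q.proj (f w) = Q.proj (f a) := DiscreteQuotient.proj_comap_eq_iff.1 hw
    have h2 : Q.proj (f (g w)) = Q.proj (f b) := DiscreteQuotient.proj_comap_eq_iff.1 hw'
    exact ⟨f w, h1, by simpa [Homeomorph.mul_apply] using h2⟩
  refine ⟨f * g * f⁻¹, by simpa using hgW, fun a => ?_, key _ _ hg⟩
  simpa using key (f⁻¹ a) (f⁻¹ a) (hgd _)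

variable [CompactSpace X] [T2Space X]

variable [Nontrivial X]

/-- If `g` links `x` and `y` to a common point, then `g⁻¹ * v * g` for a suitable `v` links `x` to
`y` and every point to itself. -/
theorem IsHHomogeneous.nearlyLinked_of_links (hX : IsHHomogeneous X) (hφ : Continuous φ) {x y : X}
    (h : ∀ (Q : DiscreteQuotient X), ∀ W ∈ 𝓝 (1 : H), ∃ g, φ g ∈ W ∧
      ∃ z, Links Q.proj g x z ∧ Links Q.proj g y z) : NearlyLinked φ x y := by
  have := hX.totallySeparatedSpace
  intro Q W hW
  obtain ⟨V, hV, hVinv, hVW⟩ := exists_symm_nhds_one_split4 hW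
  obtain ⟨P, hPQ, hP⟩ := Aut.exists_le_stabilizer_mem hφ Q hV
  obtain ⟨g, hg, z, hxz, hyz⟩ := h P V hV
  obtain ⟨v, hv, hvl⟩ := hX.exists_links_comp P.proj_isLocallyConstant g⁻¹ g
  refine ⟨g⁻¹ * v * g, ?_, fun a => ?_, (hvl x z y hxz hyz.inv).of_le hPQ⟩
  · simpa using hVW _ (hVinv _ hg) _ (hP v hv) _ hg _ (mem_of_mem_nhds hV)
  · have ha : Links P.proj g a (g a) := ⟨a, rfl, rfl⟩
    exact (hvl a _ a ha ha.inv).of_le hPQ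

/-- Elements that link each point to itself can be composed without losing the links of either
factor. -/
theorem IsHHomogeneous.exists_links_of_nearlyLinked (hX : IsHHomogeneous X) (hφ : Continuous φ)
    {κ : Type*} (s : Finset κ) {a b : κ → X} (h : ∀ k, NearlyLinked φ (a k) (b k))
    (Q : DiscreteQuotient X) {W : Set H} (hW : W ∈ 𝓝 (1 : H)) :
    ∃ g, φ g ∈ W ∧ (∀ x, Links Q.proj g x x) ∧ ∀ k ∈ s, Links Q.proj g (a k) (b k) := by
  classical
  have := hX.totallySeparatedSpace
  induction s using Finset.induction_on generalizing Q W with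
  | empty => exact ⟨1, by simpa using mem_of_mem_nhds hW, fun x => ⟨x, rfl, rfl⟩, by simp⟩
  | insert k s _ ih =>
    obtain ⟨V, hV, -, hVW⟩ := exists_symm_nhds_one_split4 hW
    obtain ⟨P, hPQ, hP⟩ := Aut.exists_le_stabilizer_mem hφ Q hV
    obtain ⟨g, hg, hgd, hgs⟩ := ih P hV
    obtain ⟨f, hf, hfd, hfk⟩ := h k P V hV
    obtain ⟨v, hv, hvl⟩ := hX.exists_links_comp P.proj_isLocallyConstant g f
    refine ⟨g * v * f, ?_, fun x => (hvl _ _ _ (hfd x) (hgd x)).of_le hPQ, fun l hl => ?_⟩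
    · simpa using hVW _ hg _ (hP v hv) _ hf _ (mem_of_mem_nhds hV)
    · rcases Finset.mem_insert.1 hl with rfl | hl
      · exact (hvl _ _ _ hfk (hgd _)).of_le hPQ
      · exact (hvl _ _ _ (hfd _) (hgs l hl)).of_le hPQ

/-- If two distinct points are nearly linked, then there are self-homeomorphisms with images
arbitrarily close to `1` that mix all pieces of a discrete quotient. -/
theorem NearlyLinked.exists_forall_links (hX : IsHHomogeneous X) (hφ : Continuous φ)
    {x y : X} (hxy : x ≠ y) (h : NearlyLinked φ x y) (Q : DiscreteQuotient X) {W : Set H}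
    (hW : W ∈ 𝓝 (1 : H)) : ∃ g, φ g ∈ W ∧ ∀ a b, Links Q.proj g a b := by
  have hinj : Function.Injective (fun t : Bool => cond t x y) := by
    rintro (_ | _) (_ | _) h
    exacts [rfl, absurd h.symm hxy, absurd h hxy, rfl]
  -- Near-linkedness is invariant, and homeomorphisms take `(x, y)` into every pair of cells; there
  -- are finitely many such pairs.
  have hf : ∀ p : Q × Q, ∃ f : X ≃ₜ X, Q.proj (f x) = p.1 ∧ Q.proj (f y) = p.2 := by
    rintro ⟨i, j⟩
    obtain ⟨a, rfl⟩ := Q.proj_surjective i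
    obtain ⟨b, rfl⟩ := Q.proj_surjective j
    obtain ⟨f, hf⟩ := hX.exists_apply_mem Q.proj_isLocallyConstant hinj (fun t : Bool => cond t a b)
    exact ⟨f, hf true, hf false⟩
  choose f hfx hfy using hf
  have := Fintype.ofFinite (Q × Q)
  obtain ⟨g, hg, -, hgl⟩ := hX.exists_links_of_nearlyLinked hφ (Finset.univ : Finset (Q × Q))
    (fun p => h.map (f p)) Q hW
  refine ⟨g, hg, fun a b => ?_⟩
  obtain ⟨w, hw, hw'⟩ := hgl (Q.proj a, Q.proj b) (Finset.mem_univ _)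
  exact ⟨w, hw.trans (hfx _), hw'.trans (hfy _)⟩

theorem IsHHomogeneous.exists_nearlyLinked_of_map_eq_one (hX : IsHHomogeneous X)
    (hφ : Continuous φ) {n : X ≃ₜ X} (hn : n ≠ 1) (hφn : φ n = 1) :
    ∃ x y, x ≠ y ∧ NearlyLinked φ x y := by
  have := hX.totallySeparatedSpace
  obtain ⟨x, hx⟩ : ∃ x, n x ≠ x := by
    by_contra! h
    exact hn (Homeomorph.ext h)
  obtain ⟨C, hC, hxC, hnC⟩ := exists_isClopen_of_totally_separated hx.symm
  -- `n` moves `U` off itself, and `U` has a second point `y`. Some `f` keeps `x` and `y` in their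
  -- cells and brings `n x` and `n y` into the cell of `x`, so the conjugate of `n` by `f`, still in
  -- the kernel, links both to `x`.
  obtain ⟨U, hU, hxU, hUn⟩ : ∃ U : Set X, IsClopen U ∧ x ∈ U ∧ ∀ u ∈ U, n u ∉ U :=
    ⟨C ∩ n ⁻¹' Cᶜ, hC.inter (hC.compl.preimage n.continuous), ⟨hxC, hnC⟩,
      fun u hu hnu => hu.2 hnu.1⟩
  obtain ⟨e⟩ := hX.homeomorphic U univ hU isClopen_univ ⟨x, hxU⟩ ⟨x, trivial⟩
  have hnt : Nontrivial U := (e.toEquiv.trans (Equiv.Set.univ X)).nontrivial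
  obtain ⟨⟨y, hyU⟩, hy⟩ := exists_ne (⟨x, hxU⟩ : U)
  have hxy : x ≠ y := fun h => hy (Subtype.ext h.symm)
  refine ⟨x, y, hxy, hX.nearlyLinked_of_links hφ fun Q W hW => ?_⟩
  let p : Bool → X := fun t => cond t x y
  have hpU : ∀ t, p t ∈ U := by rintro (_ | _) <;> assumption
  have hp : Function.Injective p := by
    rintro (_ | _) (_ | _) h
    exacts [rfl, absurd h.symm hxy, absurd h hxy, rfl]
  have hinj : Function.Injective (Sum.elim p (n ∘ p)) :=
    hp.sumElim (n.injective.comp hp) fun s t h => hUn _ (hpU t)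
      ((show p s = n (p t) from h) ▸ hpU s)
  obtain ⟨f, hf⟩ := hX.exists_apply_mem Q.proj_isLocallyConstant hinj
    (Sum.elim p fun _ => x)
  have key : ∀ t, Links Q.proj (f * n * f⁻¹) (p t) x := fun t =>
    ⟨f (p t), hf (Sum.inl t), by simpa [Homeomorph.mul_apply] using hf (Sum.inr t)⟩
  exact ⟨f * n * f⁻¹, by simpa [hφn] using mem_of_mem_nhds hW, x, key true, key false⟩

variable [T1Space H]

theorem NearlyLinked.map_eq_one (hX : IsHHomogeneous X) (hφ : Continuous φ)
    {x y : X} (hxy : x ≠ y) (hl : NearlyLinked φ x y) (h : X ≃ₜ X) : φ h = 1 := by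
  have := hX.totallySeparatedSpace
  by_contra hne
  obtain ⟨V, hV, hVinv, hVW⟩ := exists_symm_nhds_one_split4
    (isOpen_compl_singleton.mem_nhds (show (1 : H) ∈ ({φ h} : Set H)ᶜ from Ne.symm hne))
  obtain ⟨P, -, hP⟩ := Aut.exists_le_stabilizer_mem hφ ⊤ hV
  -- The partition is also refined by its pullback under `h⁻¹`, so that `f * h` has full trace on
  -- `P` as well.
  obtain ⟨f, hf, hfl⟩ := hl.exists_forall_links hX hφ hxy
    (P ⊓ P.comap ((h⁻¹ : X ≃ₜ X) : C(X, X))) hV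
  have hfh : ∀ a b, Links P.proj (f * h) a b := by
    intro a b
    obtain ⟨w, hw, hw'⟩ := hfl (h a) b
    have h1 : P.proj (h⁻¹ w) = P.proj (h⁻¹ (h a)) := DiscreteQuotient.proj_comap_eq_iff.1
      (DiscreteQuotient.proj_eq_of_le (Q := P.comap ((h⁻¹ : X ≃ₜ X) : C(X, X))) inf_le_right hw)
    refine ⟨h⁻¹ w, by simpa using h1, ?_⟩
    simpa [Homeomorph.mul_apply] using DiscreteQuotient.proj_eq_of_le inf_le_left hw'
  obtain ⟨a, b, ha, hb, hab⟩ := hX.exists_eq_mul_of_relTrace_eq P.proj_isLocallyConstant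
    ((relTrace_graph_eq_univ fun a b => (hfl a b).of_le inf_le_left).trans
      (relTrace_graph_eq_univ hfh).symm)
  refine hVW _ (hVinv _ hf) _ (hP b hb) _ hf _ (hP a ha) ?_
  rw [mem_singleton_iff, ← map_inv, ← map_mul, ← map_mul, ← map_mul, mul_assoc f⁻¹, mul_assoc f⁻¹,
    ← hab, inv_mul_cancel_left]

/-- A continuous homomorphism of `Aut X` to a Hausdorff group is trivial or a topological
embedding. -/
theorem IsHHomogeneous.map_eq_one_or_isEmbedding (hX : IsHHomogeneous X) (hφ : Continuous φ) :
    (∀ g, φ g = 1) ∨ IsEmbedding φ := by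
  have := hX.totallySeparatedSpace
  by_contra! hcon
  obtain ⟨⟨h, hh⟩, hemb⟩ := hcon
  have hnl : ∀ x y, NearlyLinked φ x y → x = y := fun x y hl => by
    by_contra hxy
    exact hh (hl.map_eq_one hX hφ hxy h)
  have hinj : Function.Injective φ := by
    refine (injective_iff_map_eq_one φ).2 fun n hn => ?_
    by_contra hne
    obtain ⟨x, y, hxy, hl⟩ := hX.exists_nearlyLinked_of_map_eq_one hφ hne hn
    exact hxy (hnl x y hl)
  obtain ⟨Q, hQ⟩ : ∃ Q : DiscreteQuotient X,
      {g : X ≃ₜ X | ∀ x, Q.proj (g x) = Q.proj x} ∉ comap φ (𝓝 1) := by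
    by_contra! hall
    refine hemb ⟨IsTopologicalGroup.isInducing_iff_nhds_one.2 (le_antisymm ?_ ?_), hinj⟩
    · exact map_le_iff_le_comap.1 ((hφ.tendsto 1).trans (by rw [map_one]))
    · exact Aut.hasBasis_nhds_one.ge_iff.2 fun Q _ => hall Q
  -- If `φ` is not an embedding, some ultrafilter has `φ`-images tending to 1 but avoids the
  -- stabilizer of `Q`. Its graphs converge to a relation `R`.
  rw [mem_iff_ultrafilter] at hQ
  push Not at hQ
  obtain ⟨𝒰, h𝒰, hQ⟩ := hQ
  obtain ⟨R, -, hR⟩ := (isCompact_univ (X := FullClosedRel X)).ultrafilter_le_nhds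
    (𝒰.map FullClosedRel.graph) (by simp)
  have htr : ∀ P : DiscreteQuotient X, ∀ᶠ g in (𝒰 : Filter (X ≃ₜ X)),
      relTrace P.proj (FullClosedRel.graph g).1 = relTrace P.proj R.1 := fun P =>
    hR (((FullClosedRel.isLocallyConstant_relTrace P).isOpen_fiber _).mem_nhds rfl)
  have hex : ∀ P : DiscreteQuotient X, ∀ W ∈ 𝓝 (1 : H), ∃ g, φ g ∈ W ∧
      relTrace P.proj (FullClosedRel.graph g).1 = relTrace P.proj R.1 := fun P W hW =>
    (inter_mem (h𝒰 (preimage_mem_comap hW)) (htr P) : _ ∈ (𝒰 : Filter (X ≃ₜ X))) |>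
      nonempty_of_mem
  have hlink : ∀ {P : DiscreteQuotient X} {g : X ≃ₜ X},
      relTrace P.proj (FullClosedRel.graph g).1 = relTrace P.proj R.1 →
      ∀ {x y}, (x, y) ∈ R.1 → Links P.proj g x y := fun hg _ _ hxy =>
    links_iff_mem_relTrace.2 (hg ▸ mk_mem_relTrace hxy)
  -- Two points `R`-related to the same point, on either side, are nearly linked, hence equal.
  obtain ⟨g, rfl⟩ : ∃ g, FullClosedRel.graph g = R := by
    refine FullClosedRel.exists_graph_eq (fun x y z hy hz => ?_) fun x y z hx hy => ?_
    · refine hnl y z (hX.nearlyLinked_of_links hφ fun P W hW => ?_)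
      obtain ⟨g, hg, hgR⟩ := hex P W⁻¹ (inv_mem_nhds_one H hW)
      exact ⟨g⁻¹, by simpa using hg, x, (hlink hgR hy).inv, (hlink hgR hz).inv⟩
    · refine hnl x y (hX.nearlyLinked_of_links hφ fun P W hW => ?_)
      obtain ⟨g, hg, hgR⟩ := hex P W hW
      exact ⟨g, hg, z, hlink hgR hx, hlink hgR hy⟩
  have hg1 : φ g = 1 := by
    by_contra hne
    obtain ⟨V, hV, -, hVW⟩ := exists_symm_nhds_one_split4
      (isOpen_compl_singleton.mem_nhds (show (1 : H) ∈ ({φ g} : Set H)ᶜ from Ne.symm hne))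
    obtain ⟨P, -, hP⟩ := Aut.exists_le_stabilizer_mem hφ ⊤ hV
    obtain ⟨f, hf, hfg⟩ := hex P V hV
    obtain ⟨a, b, ha, hb, hab⟩ := hX.exists_eq_mul_of_relTrace_eq P.proj_isLocallyConstant hfg
    refine hVW _ (hP b hb) _ hf _ (hP a ha) _ (mem_of_mem_nhds hV) ?_
    rw [mem_singleton_iff, hab, map_mul, map_mul, mul_one]
  obtain rfl : g = 1 := hinj (hg1.trans (map_one φ).symm)
  -- The limit is the diagonal, so eventually `f` has the trace of the identity on `Q`, i.e. it
  -- preserves every cell.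
  refine hQ ?_
  filter_upwards [htr Q] with f hf x
  have : Links Q.proj f x (f x) := ⟨x, rfl, rfl⟩
  rw [links_iff_mem_relTrace, hf] at this
  obtain ⟨w, hw, hw'⟩ := mem_relTrace_graph.1 this
  exact hw'.symm.trans hw

end Hom

/-! ### Minimality and topological simplicity -/

section Main

variable {X : Type*} [TopologicalSpace X] [CompactSpace X] [T2Space X]

/-- The dichotomy is applied to the identity map into the group with the coarser topology. -/
theorem IsHHomogeneous.isMinimalTopologicalGroup (hX : IsHHomogeneous X) :
    IsMinimalTopologicalGroup (X ≃ₜ X) := by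
  refine ⟨inferInstance, inferInstance, fun τ' hgrp hT2 hle => ?_⟩
  have hsub : Subsingleton (X ≃ₜ X) → τ' = Aut.instTopologicalSpace := fun _ =>
    Subsingleton.elim _ _
  rcases subsingleton_or_nontrivial X with h | h
  · exact hsub ⟨fun f g => Homeomorph.ext fun x => Subsingleton.elim _ _⟩
  have hφ : @Continuous _ _ Aut.instTopologicalSpace τ' (MonoidHom.id (X ≃ₜ X)) :=
    continuous_id_iff_le.2 hle
  rcases @IsHHomogeneous.map_eq_one_or_isEmbedding X _ (X ≃ₜ X) _ τ' hgrp (MonoidHom.id _) _ _ _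
    (@T2Space.t1Space _ τ' hT2) hX hφ with h1 | ⟨⟨h1⟩, -⟩
  · exact hsub ⟨fun f g => (h1 f).trans (h1 g).symm⟩
  · exact (h1.trans induced_id).symm

/-- The dichotomy is applied to the quotient map by `N`, whose target is separated because `N` is
closed. -/
theorem IsHHomogeneous.isTopologicallySimple (hX : IsHHomogeneous X) :
    IsTopologicallySimple (X ≃ₜ X) := by
  intro N hN hNc
  rcases subsingleton_or_nontrivial X with h | h
  · have : Subsingleton (X ≃ₜ X) := ⟨fun f g => Homeomorph.ext fun x => Subsingleton.elim _ _⟩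
    exact Or.inl (Subsingleton.elim _ _)
  rcases hX.map_eq_one_or_isEmbedding (φ := QuotientGroup.mk' N) QuotientGroup.continuous_mk
    with h1 | h1
  · exact Or.inr ((Subgroup.eq_top_iff' N).2 fun g => (QuotientGroup.eq_one_iff g).1 (h1 g))
  · left
    rw [← QuotientGroup.ker_mk' N]
    exact (MonoidHom.ker_eq_bot_iff _).2 h1.injective

end Main

/-- Let `X` be an `h`-homogeneous compact Hausdorff space and `G = Aut X` with the compact-open
topology. Then `G` is Roelcke-precompact; its Roelcke compactification is identified with the
semigroup `E₀(X)`, by a homeomorphism that extends the embedding of `G` in `E₀(X)` by graphs, an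
isomorphism of `G` to the group of invertible elements of `E₀(X)`; and `G` is minimal and
topologically simple. -/
theorem theorem1p1 (X : Type*) [TopologicalSpace X] [CompactSpace X] [T2Space X]
    (hX : IsHHomogeneous X) :
    (IsRoelckePrecompact (X ≃ₜ X) ∧
      Function.Injective (FullClosedRel.graphHom X) ∧
      Set.range (FullClosedRel.graphHom X) = {R : FullClosedRel X | IsUnit R} ∧
      ∃ Φ : RoelckeCompletion (X ≃ₜ X) ≃ₜ FullClosedRel X,
        ∀ g : X ≃ₜ X, Φ (RoelckeCompletion.of g) = FullClosedRel.graphHom X g) ∧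
    (IsMinimalTopologicalGroup (X ≃ₜ X) ∧ IsTopologicallySimple (X ≃ₜ X)) :=
  ⟨⟨hX.isRoelckePrecompact, FullClosedRel.graphHom_injective, FullClosedRel.range_graphHom,
    hX.exists_homeomorph_roelckeCompletion⟩, hX.isMinimalTopologicalGroup, hX.isTopologicallySimple⟩
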